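/- Let $T$ be a tree, meaning a directed acyclic graph on $[n]=\{1,\dots,n\}$ whose edges $i\to j$ all satisfy $i<j$ and whose underlying undirected graph is a tree. A trek from $i$ to $j$ is a simple path $P$ between $i$ and $j$ in $T$ (edges may be traversed in either direction) that contains no two distinct edges $u\to k$, $w\to k$ with the same head; $\mathrm{top}(P)$ is the vertex of $P$ into which no edge of $P$ points, and $T(i,j)$ is the set of treks from $i$ to $j$ (it has at most one element, and $T(i,i)$ consists of the empty trek). Let $$\phi_T:\ \mathbb{C}[\sigma_{ij}\mid 1\le i\le j\le n]\to\mathbb{C}[a_i,\lambda_{kl}\mid i\in[n],\ k\to l\in E(T)],\qquad \sigma_{ij}\mapsto\sum_{P\in T(i,j)}a_{\mathrm{top}(P)}\prod_{k\to l\in P}\lambda_{kl},$$ let $I_T=\ker\phi_T$, let $A_T$ be the set of the exponent vectors $\mathbf a_{ij}\in\mathbb{Z}^{2n-1}$ of the monomials $\phi_T(\sigma_{ij})$ for the pairs $i\le j$ with $T(i,j)\neq\emptyset$, and let $P_T=\mathrm{conv}(A_T)$. Let $\prec$ be any (graded) reverse lexicographic term order on $\mathbb{C}[\sigma_{ij}]$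 such that $\sigma_{ii}\succ\sigma_{jk}$ for all $i$ and all $j<k$. Then: 1. the initial ideal $\mathrm{in}_\prec(I_T)$ is a squarefree monomial ideal; 2. the associated pulling triangulation of $P_T$ is unimodular, i.e. the vertices of each of its maximal simplices form a $\mathbb{Z}$-basis of the lattice $\mathbb{Z}A_T$. Here the pulling triangulation is the one in which the points $\mathbf a_{ij}$ are pulled in the order of the variables $\sigma_{ij}$, $\prec$-smallest first: the maximal simplices of the triangulation of a nonempty face $F$ are the joins of the $\prec$-smallest point $v$ of $A_T\cap F$ with the maximal simplices of the pulling triangulations of the facets of $F$ not containing $v$, where the only maximal simplex of the empty face is the empty one. -/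

import Mathlib

open scoped MonomialOrder

namespace GaussianDAG

/-! ### Directed acyclic graphs and treks -/

/-- A directed acyclic graph on the vertices `0, …, n - 1` that is numerically ordered:
`i → j` is an edge only if `i < j`. -/
structure DAG (n : ℕ) extends Digraph (Fin n) where
  lt_of_adj : ∀ i j : Fin n, Adj i j → i < j

variable {n : ℕ}

/-- The underlying undirected graph. -/
abbrev DAG.skeleton (G : DAG n) : SimpleGraph (Fin n) :=
  G.toDigraph.toSimpleGraphInclusive

/-- A tree is a DAG whose underlying undirected graph is a tree (a polytree). -/
def DAG.IsTree (G : DAG n) : Prop := G.skeleton.IsTree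

/-- The type of directed edges `i → j` of `G`. -/
abbrev DAG.Edge (G : DAG n) : Type := {e : Fin n × Fin n // G.Adj e.1 e.2}

/-- The directed edge `k → l` of `G` is traversed (in either direction) by the walk `p`. -/
def DAG.Uses (G : DAG n) {i j : Fin n} (p : G.skeleton.Walk i j) (k l : Fin n) : Prop :=
  G.Adj k l ∧ s(k, l) ∈ p.edges

/-- `T(i, j)`: the simple paths from `i` to `j` in `G` (edges may be traversed in either
direction) without a collider, that is, without two distinct edges `u → k`, `w → k`. -/
def DAG.Trek (G : DAG n) (i j : Fin n) : Type :=
  {p : G.skeleton.Path i j //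
    ∀ u w k : Fin n, G.Uses p.1 u k → G.Uses p.1 w k → u = w}

noncomputable instance (G : DAG n) (i j : Fin n) : Fintype (G.Trek i j) := by
  classical
  unfold DAG.Trek
  infer_instance

variable {G : DAG n} {i j : Fin n}

/-- The walk underlying a trek. -/
def DAG.Trek.walk (P : G.Trek i j) : G.skeleton.Walk i j := P.1.1

theorem DAG.Trek.exists_top (P : G.Trek i j) :
    ∃ t ∈ P.walk.support, ∀ k : Fin n, ¬ G.Uses P.walk k t := by
  obtain ⟨t, ht, hmin⟩ := P.walk.support.toFinset.exists_min_image id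
    ⟨i, by simp⟩
  refine ⟨t, by simpa using ht, fun k hk => ?_⟩
  have h1 : k ∈ P.walk.support := P.walk.fst_mem_support_of_mem_edges hk.2
  exact absurd (hmin k (by simpa using h1)) (not_le.2 (G.lt_of_adj _ _ hk.1))

/-- The topmost vertex of a trek: the vertex of the trek into which no edge of the trek
points. -/
noncomputable def DAG.Trek.top (P : G.Trek i j) : Fin n := P.exists_top.choose

/-! ### The parametrization and its ideal -/

/-- The index set `{(i, j) : i ≤ j}` of the variables `σ_ij`. -/
abbrev SigmaVar (n : ℕ) : Type := {p : Fin n × Fin n // p.1 ≤ p.2}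

/-- The index set of the parameters: `a_i` for the vertices `i`, `λ_kl` for the edges
`k → l`. -/
abbrev DAG.Param (G : DAG n) : Type := Fin n ⊕ G.Edge

open scoped Classical in
/-- The monomial `a_top(P) * ∏_{k → l ∈ P} λ_kl` of a trek `P`. -/
noncomputable def DAG.Trek.monomial (P : G.Trek i j) : MvPolynomial G.Param ℂ :=
  MvPolynomial.X (Sum.inl P.top) *
    ∏ e : G.Edge with G.Uses P.walk e.1.1 e.1.2, MvPolynomial.X (Sum.inr e)

/-- The trek rule homomorphism `φ_G`, `σ_ij ↦ ∑_{P ∈ T(i,j)} a_top(P) ∏_{k → l ∈ P} λ_kl`. -/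
noncomputable def DAG.phi (G : DAG n) :
    MvPolynomial (SigmaVar n) ℂ →ₐ[ℂ] MvPolynomial G.Param ℂ :=
  MvPolynomial.aeval fun p => ∑ P : G.Trek p.1.1 p.1.2, P.monomial

/-- The ideal `I_G = ker φ_G`. -/
noncomputable def DAG.ideal (G : DAG n) : Ideal (MvPolynomial (SigmaVar n) ℂ) :=
  RingHom.ker G.phi

/-! ### Term orders and initial ideals -/

/-- `m` is the (graded) reverse lexicographic term order for the order it induces on the
variables: `x^a ≺ x^b` if and only if `deg a < deg b`, or the degrees agree and, for the
`≺`-smallest variable `x_i` whose exponents in `x^a` and `x^b` differ, `a_i > b_i`. -/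
def IsRevLex {σ : Type*} (m : MonomialOrder σ) : Prop :=
  ∀ a b : σ →₀ ℕ, a ≺[m] b ↔
    a.degree < b.degree ∨
      a.degree = b.degree ∧ ∃ i : σ, b i < a i ∧
        ∀ j : σ, Finsupp.single j 1 ≺[m] Finsupp.single i 1 → a j = b j

/-- The initial ideal `in_≺(I)`, generated by the leading terms of the elements of `I`. -/
noncomputable def initialIdeal {σ k : Type*} [CommSemiring k] (m : MonomialOrder σ)
    (I : Ideal (MvPolynomial σ k)) : Ideal (MvPolynomial σ k) :=
  Ideal.span (m.leadingTerm '' (I : Set (MvPolynomial σ k)))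

/-- `I` is a squarefree monomial ideal: it is generated by monomials all of whose exponents
are at most `1`. -/
def IsSquarefreeMonomialIdeal {σ k : Type*} [CommSemiring k]
    (I : Ideal (MvPolynomial σ k)) : Prop :=
  ∃ S : Set (σ →₀ ℕ), (∀ s ∈ S, ∀ i, s i ≤ 1) ∧
    I = Ideal.span ((fun s => MvPolynomial.monomial s (1 : k)) '' S)

/-! ### Pulling triangulations of lattice point configurations -/

section Pulling

variable {ι κ : Type*}

/-- The point `a_i` of an integral configuration, as a real vector. -/
def realPoint (a : ι → κ → ℤ) (i : ι) : κ → ℝ := fun x => (a i x : ℝ)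

/-- The polytope `conv {a_i : i ∈ F}`. -/
def polytope (a : ι → κ → ℤ) (F : Set ι) : Set (κ → ℝ) :=
  convexHull ℝ (realPoint a '' F)

/-- `H` is the set of labels of the configuration points in `F` that lie on some face
(possibly empty, possibly improper) of the polytope `conv {a_i : i ∈ F}`. -/
def IsFace (a : ι → κ → ℤ) (F H : Finset ι) : Prop :=
  ∃ Q : Set (κ → ℝ), IsExposed ℝ (polytope a F) Q ∧
    ∀ i, i ∈ H ↔ i ∈ F ∧ realPoint a i ∈ Q

/-- `H` labels a facet of the polytope `conv {a_i : i ∈ F}`: a maximal proper face. -/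
def IsFacet (a : ι → κ → ℤ) (F H : Finset ι) : Prop :=
  IsFace a F H ∧ H ≠ F ∧ ∀ K, IsFace a F K → H ⊆ K → K = H ∨ K = F

/-- `IsPullingSimplex a r F S`: the set `S` labels the vertices of a maximal simplex of the
pulling triangulation of `conv {a_i : i ∈ F}` in which the points are pulled in the order `r`,
smallest first. Recursively, these simplices are the joins of the smallest point `v` of `F`
with the maximal simplices of the pulling triangulations of the facets that do not
contain `v`. -/
inductive IsPullingSimplex [DecidableEq ι] (a : ι → κ → ℤ) (r : ι → ι → Prop) :
    Finset ι → Finset ι → Prop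
  | empty : IsPullingSimplex a r ∅ ∅
  | pull {F H S : Finset ι} {v : ι} (hv : v ∈ F) (hmin : ∀ w ∈ F, w ≠ v → r v w)
      (hH : IsFacet a F H) (hvH : v ∉ H) (hS : IsPullingSimplex a r H S) :
      IsPullingSimplex a r F (insert v S)

/-- The simplex with vertices `a_i`, `i ∈ S`, is unimodular with respect to the lattice
`ℤA` spanned by the configuration `A = {a_i}` (whose points lie on an affine
hyperplane that misses the origin): its vertices form a `ℤ`-basis of `ℤA`. -/
def IsUnimodularSimplex (a : ι → κ → ℤ) (S : Finset ι) : Prop :=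
  LinearIndependent ℤ (fun i : S => a i) ∧
    Submodule.span ℤ (a '' S) = Submodule.span ℤ (Set.range a)

/-- The pulling triangulation of `conv {a_i}` with respect to the order `r` is unimodular. -/
def PullingUnimodular [Fintype ι] [DecidableEq ι] (a : ι → κ → ℤ)
    (r : ι → ι → Prop) : Prop :=
  ∀ S : Finset ι, IsPullingSimplex a r Finset.univ S → IsUnimodularSimplex a S

end Pulling

/-! ### The point configuration of a tree -/

open scoped Classical in
/-- The exponent vector of the monomial of a trek. -/
noncomputable def DAG.Trek.exponent (P : G.Trek i j) : G.Param → ℕ :=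
  Sum.elim (fun v => if v = P.top then 1 else 0)
    (fun e => if G.Uses P.walk e.1.1 e.1.2 then 1 else 0)

open scoped Classical in
theorem DAG.Trek.monomial_eq (P : G.Trek i j) :
    P.monomial = ∏ x : G.Param, MvPolynomial.X x ^ P.exponent x := by
  simp [DAG.Trek.monomial, DAG.Trek.exponent, Finset.prod_filter, Fintype.prod_sum_type,
    pow_ite, Finset.prod_ite_eq']

/-- The labels of the points `a_ij`: the pairs `i ≤ j` for which `T(i, j)` is nonempty. -/
abbrev DAG.TrekPair (G : DAG n) : Type :=
  {p : SigmaVar n // Nonempty (G.Trek p.1.1 p.1.2)}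

/-- The configuration `A_T`: the point `a_ij` is the exponent vector of the trek from `i` to
`j` (which is unique when `G` is a tree). The polytope `P_T` is the convex hull of these
points. -/
noncomputable def DAG.config (G : DAG n) (p : G.TrekPair) : G.Param → ℤ :=
  fun x => ((Classical.choice p.2).exponent x : ℤ)

end GaussianDAG

/-! Both claims follow from one property of the configuration, `IsNearlyCompressed`: integral
functionals `g c` cut out exactly the semigroup generated by the points, they take only the values 0
and 1 on points outside a set `D`, and the points of `D` have dual functionals among the `g c`. For
a tree, `D` is the diagonal: the points `a_ii` are unit vectors, and only there can a functional
(the number of trek ends at a vertex) reach 2. The order makes the diagonal variables the largest,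
so these points are pulled last.

One exchange argument serves both halves. If `b` is a sum of points and every `g c` with value 1 at
a point `a v` outside `D` is positive at `b`, then `b - a v` satisfies all inequalities, hence is
again a sum of points. For pulling, this shows that a facet missing the first point `v` has lattice
height one under it (`exists_height_one`), and unimodularity follows by induction on faces
(`pullingSimplex`). For the initial ideal, it replaces a nonstandard monomial by a squarefree
nonstandard divisor (`exists_squarefree`).

The combinatorial core is `exists_sum_trekVectors`: an integral vector satisfying the inequalities
is a sum of trek vectors. One unit is removed from an edge with positive weight and largest head,
the rest is decomposed by induction, and the edge is put back by lengthening a trek, after an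
exchange of tails if necessary (`exists_extension`). -/

namespace GaussianDAG

/-! ### Faces, facets and pulling triangulations of nearly compressed configurations. -/

section Configuration

variable {ι κ : Type*}

/-- The real linear functional that extends an additive functional on `ℤ^κ`. -/
noncomputable def extendFunctional [Fintype κ] [DecidableEq κ] (k : (κ → ℤ) →+ ℝ) :
    (κ → ℝ) →L[ℝ] ℝ :=
  ∑ x, k (Pi.single x 1) • ContinuousLinearMap.proj x

theorem extendFunctional_realPoint [Fintype κ] [DecidableEq κ] (k : (κ → ℤ) →+ ℝ)
    (a : ι → κ → ℤ) (i : ι) : extendFunctional k (realPoint a i) = k (a i) := by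
  have h : a i = ∑ x, a i x • (Pi.single x 1 : κ → ℤ) := by
    ext y
    simp [Finset.sum_apply, Pi.single_apply]
  conv_rhs => rw [h, map_sum]
  rw [extendFunctional, sum_apply]
  refine Finset.sum_congr rfl fun x _ => ?_
  rw [map_zsmul, zsmul_eq_mul]
  exact mul_comm _ _

/-- The additive functional on `ℤ^κ` obtained by restricting a real linear functional. -/
noncomputable def restrictFunctional (l : (κ → ℝ) →L[ℝ] ℝ) : (κ → ℤ) →+ ℝ where
  toFun z := l fun x => (z x : ℝ)
  map_zero' := by
    convert map_zero l using 2
    ext; simp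
  map_add' z w := by
    rw [← map_add]
    congr 1
    ext; simp

theorem restrictFunctional_apply (l : (κ → ℝ) →L[ℝ] ℝ) (a : ι → κ → ℤ) (i : ι) :
    restrictFunctional l (a i) = l (realPoint a i) := rfl

variable {a : ι → κ → ℤ}

/-- As the points lie on the hyperplane `d = 1`, an affine support condition `l ≤ l x` homogenizes
to nonnegativity of `l x * d - l`. The empty face is cut out by `d` itself. -/
theorem isFace_iff [Finite κ] {d : (κ → ℤ) →+ ℝ} (hd : ∀ i, d (a i) = 1) {F H : Finset ι} :
    IsFace a F H ↔ ∃ k : (κ → ℤ) →+ ℝ, (∀ i ∈ F, 0 ≤ k (a i)) ∧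
      ∀ i, i ∈ H ↔ i ∈ F ∧ k (a i) = 0 := by
  classical
  cases nonempty_fintype κ
  constructor
  · rintro ⟨Q, hQ, hH⟩
    rcases Q.eq_empty_or_nonempty with rfl | hne
    · refine ⟨d, fun i _ => by simp [hd], fun i => by simp [hH, hd]⟩
    · obtain ⟨l, rfl⟩ := hQ hne
      obtain ⟨x, hxA, hx⟩ := hne
      have hmem : ∀ i ∈ F, realPoint a i ∈ polytope a (F : Set ι) := fun i hi =>
        subset_convexHull ℝ _ ⟨i, hi, rfl⟩
      have hk : ∀ i, ((AddMonoidHom.mulLeft (l x)).comp d - restrictFunctional l) (a i)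
          = l x - l (realPoint a i) := fun i => by
        simp [hd, restrictFunctional_apply]
      refine ⟨(AddMonoidHom.mulLeft (l x)).comp d - restrictFunctional l, fun i hi => ?_,
        fun i => ?_⟩
      · rw [hk]
        linarith [hx _ (hmem i hi)]
      · rw [hH, hk]
        refine and_congr_right fun hi => ?_
        constructor
        · rintro ⟨-, h⟩
          linarith [hx _ (hmem i hi), h x hxA]
        · intro h
          exact ⟨hmem i hi, fun y hy => by linarith [hx y hy]⟩
  · rintro ⟨k, hk, hH⟩
    rcases H.eq_empty_or_nonempty with rfl | ⟨i₀, hi₀⟩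
    · exact ⟨∅, fun h => absurd h (by simp), fun i => by simp⟩
    · let l := -extendFunctional k
      have hl : ∀ i, l (realPoint a i) = -k (a i) := fun i => by
        simp [l, extendFunctional_realPoint]
      have hle : ∀ y ∈ polytope a (F : Set ι), l y ≤ 0 := by
        have : polytope a (F : Set ι) ⊆ {y | l y ≤ 0} := by
          refine convexHull_min ?_ (convex_halfSpace_le l.toLinearMap.isLinear 0)
          rintro _ ⟨i, hi, rfl⟩
          simpa [hl] using hk i hi
        exact this
      have hmem : ∀ i ∈ F, realPoint a i ∈ polytope a (F : Set ι) := fun i hi =>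
        subset_convexHull ℝ _ ⟨i, hi, rfl⟩
      refine ⟨{x ∈ polytope a (F : Set ι) | ∀ y ∈ polytope a (F : Set ι), l y ≤ l x},
        fun _ => ⟨l, rfl⟩, fun i => ?_⟩
      rw [hH]
      refine and_congr_right fun hi => ?_
      constructor
      · intro h
        exact ⟨hmem i hi, fun y hy => by rw [hl, h, neg_zero]; exact hle y hy⟩
      · rintro ⟨-, h⟩
        have h₀ := (hH i₀).1 hi₀
        have := h _ (hmem i₀ h₀.1)
        rw [hl, hl, h₀.2] at this
        linarith [hk i hi]

/-- A functional that vanishes on a facet `H` of `F` is determined on `F` up to a scalar. -/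
theorem IsFacet.proportional [Finite κ] {d : (κ → ℤ) →+ ℝ} (hd : ∀ i, d (a i) = 1)
    {F H : Finset ι} (hH : IsFacet a F H) {h : (κ → ℤ) →+ ℝ} (hpos : ∀ i ∈ F, 0 ≤ h (a i))
    (hiff : ∀ i, i ∈ H ↔ i ∈ F ∧ h (a i) = 0) {k : (κ → ℤ) →+ ℝ}
    (hk : ∀ i ∈ H, k (a i) = 0) : ∃ c : ℝ, ∀ i ∈ F, k (a i) = c * h (a i) := by
  classical
  have hHF : H ⊆ F := fun i hi => ((hiff i).1 hi).1
  have hne : (F \ H).Nonempty :=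
    Finset.sdiff_nonempty.2 fun h' => hH.2.1 (Finset.Subset.antisymm hHF h')
  have hpos' : ∀ i ∈ F \ H, 0 < h (a i) := fun i hi => by
    rw [Finset.mem_sdiff] at hi
    exact lt_of_le_of_ne (hpos i hi.1) fun h0 => hi.2 ((hiff i).2 ⟨hi.1, h0.symm⟩)
  obtain ⟨u, hu, hmax⟩ := (F \ H).exists_max_image (fun i => k (a i) / h (a i)) hne
  -- With `c` the largest ratio, `c * h - k` is nonnegative on `F` and vanishes on `H` and at `u ∉
  -- H`. Its zero set is a face strictly larger than the facet `H`, hence all of `F`.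
  set c := k (a u) / h (a u) with hc
  have hval : ∀ i, ((AddMonoidHom.mulLeft c).comp h - k) (a i) = c * h (a i) - k (a i) :=
    fun i => by simp
  let K := F.filter fun i => ((AddMonoidHom.mulLeft c).comp h - k) (a i) = 0
  have hK : IsFace a F K := by
    refine (isFace_iff hd).2 ⟨(AddMonoidHom.mulLeft c).comp h - k, fun i hi => ?_,
      fun i => by simp only [K, Finset.mem_filter]⟩
    rw [hval]
    by_cases hiH : i ∈ H
    · rw [hk i hiH, ((hiff i).1 hiH).2]; simp
    · have hi' : i ∈ F \ H := Finset.mem_sdiff.2 ⟨hi, hiH⟩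
      have : k (a i) / h (a i) ≤ c := hmax i hi'
      rw [div_le_iff₀ (hpos' i hi')] at this
      linarith
  have hsub : H ⊆ K := fun i hi => by
    refine Finset.mem_filter.2 ⟨hHF hi, ?_⟩
    rw [hval, hk i hi, ((hiff i).1 hi).2]; simp
  have huK : u ∈ K := by
    refine Finset.mem_filter.2 ⟨(Finset.mem_sdiff.1 hu).1, ?_⟩
    rw [hval, hc, div_mul_cancel₀ _ (hpos' u hu).ne', sub_self]
  have hKF : K = F := (hH.2.2 K hK hsub).resolve_left fun h' =>
    (Finset.mem_sdiff.1 hu).2 (h' ▸ huK)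
  refine ⟨c, fun i hi => ?_⟩
  have := (Finset.mem_filter.1 (hKF ▸ hi : i ∈ K)).2
  rw [hval] at this
  linarith

/-- A configuration with a system `g` of integral functionals that cuts out the semigroup
generated by the configuration, such that every point outside of `D` has height at most `1`
with respect to `g`, and such that the points in `D` have dual functionals. -/
structure IsNearlyCompressed {γ : Type*} (a : ι → κ → ℤ) (d : (κ → ℤ) →+ ℤ)
    (g : γ → (κ → ℤ) →+ ℤ) (D : Set ι) : Prop where
  degree : ∀ i, d (a i) = 1
  nonneg : ∀ c i, 0 ≤ g c (a i)
  generate : ∀ z, (∀ c, 0 ≤ g c z) → ∃ M : Multiset ι, z = (M.map a).sum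
  height_le : ∀ i ∉ D, ∀ c, g c (a i) ≤ 1
  dual : ∀ i ∈ D, ∃ c, g c (a i) = 1 ∧ ∀ j ∈ D, j ≠ i → g c (a j) = 0

variable {γ : Type*} {d : (κ → ℤ) →+ ℤ} {g : γ → (κ → ℤ) →+ ℤ} {D : Set ι}

/-- The facets of a face `F` that miss the first point `v` of `F` have height one under `v`. -/
theorem IsNearlyCompressed.exists_height_one (ha : IsNearlyCompressed a d g D)
    {r : ι → ι → Prop} (hr : ∀ i j, r i j → ¬ r j i) (hD : ∀ i ∉ D, ∀ j ∈ D, r i j)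
    {F H : Finset ι} {f h : (κ → ℤ) →+ ℝ} (hf : ∀ i, 0 ≤ f (a i))
    (hF : ∀ i, i ∈ F ↔ f (a i) = 0) (hpos : ∀ i ∈ F, 0 ≤ h (a i))
    (hiff : ∀ i, i ∈ H ↔ i ∈ F ∧ h (a i) = 0) {v : ι} (hv : v ∈ F) (hvH : v ∉ H)
    (hmin : ∀ w ∈ F, w ≠ v → r v w) :
    ∃ c, g c (a v) = 1 ∧ ∀ i ∈ H, g c (a i) = 0 := by
  by_cases hvD : v ∈ D
  · obtain ⟨c, hc, hc'⟩ := ha.dual v hvD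
    refine ⟨c, hc, fun i hi => ?_⟩
    have hne : i ≠ v := fun h' => hvH (h' ▸ hi)
    refine hc' i ?_ hne
    by_contra hiD
    exact hr _ _ (hmin i ((hiff i).1 hi).1 hne) (hD i hiD v hvD)
  · by_contra! hcon
    -- Under `hcon`, each functional of height one at `v` is at least 1 at some point of `H`, which
    -- pays for subtracting `a v`.
    obtain ⟨M, hM⟩ := ha.generate (∑ i ∈ H, a i - a v) fun c => by
      rw [map_sub, map_sum]
      have hle := ha.height_le v hvD c
      have hsum : ∀ i ∈ H, 0 ≤ g c (a i) := fun i _ => ha.nonneg c i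
      rcases (ha.nonneg c v).eq_or_lt with h0 | h0
      · rw [← h0, sub_zero]
        exact Finset.sum_nonneg hsum
      · obtain ⟨i, hi, hne⟩ := hcon c (by omega)
        have h1 := Finset.single_le_sum hsum hi
        have h2 := ha.nonneg c i
        omega
    have hfz : (M.map fun i => f (a i)).sum = 0 := by
      have h1 := congrArg f hM
      rw [map_sub, map_sum, (hF v).1 hv, Finset.sum_eq_zero fun i hi =>
        (hF i).1 ((hiff i).1 hi).1, map_multiset_sum, Multiset.map_map] at h1
      simpa using h1.symm
    have hMF : ∀ i ∈ M, i ∈ F := fun i hi => by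
      refine (hF i).2 ?_
      refine (Multiset.all_zero_of_le_zero_le_of_sum_eq_zero (s := M.map fun i => f (a i))
        ?_ hfz _ (Multiset.mem_map_of_mem _ hi))
      intro x hx
      obtain ⟨j, -, rfl⟩ := Multiset.mem_map.1 hx
      exact hf j
    have hhz : 0 ≤ h (∑ i ∈ H, a i - a v) := by
      rw [hM, map_multiset_sum, Multiset.map_map]
      refine Multiset.sum_nonneg fun x hx => ?_
      obtain ⟨j, hj, rfl⟩ := Multiset.mem_map.1 hx
      exact hpos j (hMF j hj)
    rw [map_sub, map_sum, Finset.sum_eq_zero fun i hi => ((hiff i).1 hi).2] at hhz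
    exact hvH ((hiff v).2 ⟨hv, le_antisymm (by linarith) (hpos v hv)⟩)

/-- The last conclusion says that every integral vector in the real span of the face `F` is an
integral combination of the vertices of the simplex, the real span being described by the
functionals vanishing on `F`. The hypothesis `hF`, that `F` is a face of the whole configuration, is
what the induction carries along. -/
theorem IsNearlyCompressed.pullingSimplex [Finite ι] [Finite κ] [DecidableEq ι]
    (ha : IsNearlyCompressed a d g D) {r : ι → ι → Prop} (hr : ∀ i j, r i j → ¬ r j i)
    (hD : ∀ i ∉ D, ∀ j ∈ D, r i j) {F S : Finset ι} (hS : IsPullingSimplex a r F S)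
    (hF : ∃ f : (κ → ℤ) →+ ℝ, (∀ i, 0 ≤ f (a i)) ∧ ∀ i, i ∈ F ↔ f (a i) = 0) :
    S ⊆ F ∧ LinearIndepOn ℤ a (S : Set ι) ∧
      ∀ z : κ → ℤ, (∀ k : (κ → ℤ) →+ ℝ, (∀ i ∈ F, k (a i) = 0) → k z = 0) →
        z ∈ Submodule.span ℤ (a '' S) := by
  induction hS with
  | empty =>
    refine ⟨subset_rfl, by simp, fun z hz => ?_⟩
    have : z = 0 := by
      ext x
      have := hz ((Int.castAddHom ℝ).comp (Pi.evalAddMonoidHom (fun _ : κ => ℤ) x)) (by simp)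
      simpa using this
    rw [this]
    exact Submodule.zero_mem _
  | @pull F H S v hv hmin hH hvH hS ih =>
    cases nonempty_fintype ι
    obtain ⟨f, hf, hF⟩ := hF
    have hdR : ∀ i, (Int.castAddHom ℝ).comp d (a i) = 1 := fun i => by simp [ha.degree]
    obtain ⟨h, hpos, hiff⟩ := (isFace_iff hdR).1 hH.1
    have hHface : ∃ f : (κ → ℤ) →+ ℝ, (∀ i, 0 ≤ f (a i)) ∧ ∀ i, i ∈ H ↔ f (a i) = 0 := by
      have key : ∃ N : ℝ, ∀ i, i ∉ F → 0 < N * f (a i) + h (a i) := by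
        -- A face of a face is a face: a large multiple of `f` makes `N * f + h` positive off `F`.
        -- Points of `F` contribute 0 to this sum, through division by zero.
        refine ⟨∑ i, (|h (a i)| + 1) / f (a i), fun i hi => ?_⟩
        have hfi : 0 < f (a i) := lt_of_le_of_ne (hf i) fun h0 => hi ((hF i).2 h0.symm)
        have h1 : (|h (a i)| + 1) / f (a i) ≤ ∑ i, (|h (a i)| + 1) / f (a i) :=
          Finset.single_le_sum (f := fun i => (|h (a i)| + 1) / f (a i))
            (fun j _ => div_nonneg (by positivity) (hf j)) (Finset.mem_univ i)
        rw [div_le_iff₀ hfi] at h1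
        linarith [neg_abs_le (h (a i))]
      obtain ⟨N, hN⟩ := key
      have hval : ∀ i, ((AddMonoidHom.mulLeft N).comp f + h) (a i) = N * f (a i) + h (a i) :=
        fun i => by simp
      refine ⟨(AddMonoidHom.mulLeft N).comp f + h, fun i => ?_, fun i => ?_⟩
      · rw [hval]
        by_cases hi : i ∈ F
        · rw [(hF i).1 hi]
          simpa using hpos i hi
        · exact (hN i hi).le
      · rw [hval, hiff]
        by_cases hi : i ∈ F
        · simp [hi, (hF i).1 hi]
        · simp [hi, (hN i hi).ne']
    obtain ⟨hSH, hli, hspan⟩ := ih hHface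
    obtain ⟨c, hcv, hcH⟩ := ha.exists_height_one hr hD hf hF hpos hiff hv hvH hmin
    have hvS : v ∉ S := fun h' => hvH (hSH h')
    have hHF : H ⊆ F := fun i hi => ((hiff i).1 hi).1
    refine ⟨Finset.insert_subset hv (hSH.trans hHF), ?_, fun z hz => ?_⟩
    · rw [linearIndepOn_finset_iff] at hli ⊢
      intro w hw
      rw [Finset.sum_insert hvS] at hw
      have hwv : w v = 0 := by
        have := congrArg (g c) hw
        rw [map_add, map_zsmul, hcv, map_sum, Finset.sum_eq_zero fun i hi => by
          rw [map_zsmul, hcH i (hSH hi), smul_zero]] at this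
        simpa using this
      rw [hwv, zero_smul, zero_add] at hw
      intro i hi
      rcases Finset.mem_insert.1 hi with rfl | hi
      · exact hwv
      · exact hli w hw i hi
    · have hsub : z - g c z • a v ∈ Submodule.span ℤ (a '' S) := by
        refine hspan _ fun k hk => ?_
        obtain ⟨s, hs⟩ := hH.proportional hdR hpos hiff hk
        obtain ⟨t, ht⟩ := hH.proportional hdR hpos hiff
          (k := (Int.castAddHom ℝ).comp (g c)) (fun i hi => by simp [hcH i hi])
        have htv : 1 = t * h (a v) := by simpa [hcv] using ht v hv
        have ht0 : t ≠ 0 := fun h0 => by simp [h0] at htv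
        have hkz := hz (k - (AddMonoidHom.mulLeft (s / t)).comp ((Int.castAddHom ℝ).comp (g c)))
          fun i hi => by
            have := ht i hi
            simp only [AddMonoidHom.coe_comp, Function.comp_apply] at this
            simp only [AddMonoidHom.sub_apply, AddMonoidHom.coe_comp, Function.comp_apply,
              AddMonoidHom.coe_mulLeft, this, hs i hi]
            field_simp
            ring
        simp only [AddMonoidHom.sub_apply, AddMonoidHom.coe_comp, Function.comp_apply,
              AddMonoidHom.coe_mulLeft, Int.coe_castAddHom] at hkz
        have hkv : k (a v) = s / t := by
          rw [hs v hv, eq_div_iff ht0]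
          linear_combination -s * htv
        rw [map_sub, map_zsmul, hkv, zsmul_eq_mul]
        linear_combination hkz
      have hmono : Submodule.span ℤ (a '' S) ≤ Submodule.span ℤ (a '' (insert v S : Finset ι)) :=
        Submodule.span_mono (Set.image_mono (by simp))
      have hvmem : a v ∈ Submodule.span ℤ (a '' (insert v S : Finset ι)) :=
        Submodule.subset_span ⟨v, by simp, rfl⟩
      have := Submodule.add_mem _ (hmono hsub) (Submodule.smul_mem _ (g c z) hvmem)
      simpa using this

theorem IsNearlyCompressed.pullingUnimodular [Fintype ι] [Finite κ] [DecidableEq ι]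
    (ha : IsNearlyCompressed a d g D) {r : ι → ι → Prop} (hr : ∀ i j, r i j → ¬ r j i)
    (hD : ∀ i ∉ D, ∀ j ∈ D, r i j) : PullingUnimodular a r := by
  intro S hS
  obtain ⟨-, hli, hspan⟩ := ha.pullingSimplex hr hD hS ⟨0, by simp, by simp⟩
  refine ⟨hli, le_antisymm (Submodule.span_mono (Set.image_subset_range _ _)) ?_⟩
  rw [Submodule.span_le]
  rintro _ ⟨i, rfl⟩
  exact hspan _ fun k hk => hk i (Finset.mem_univ i)

end Configuration

/-! ### Squarefree initial ideals of kernels of monomial maps. -/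

section InitialIdeal

open MvPolynomial

variable {σ κ γ : Type*} {P : σ → Prop}

theorem single_injective_toSyn (m : MonomialOrder σ) {i j : σ}
    (h : m.toSyn (Finsupp.single i 1) = m.toSyn (Finsupp.single j 1)) : i = j :=
  Finsupp.single_left_injective one_ne_zero (m.toSyn.injective h)

theorem degree_eq_of_support [Fintype σ] {a : σ → κ → ℤ} {d : (κ → ℤ) →+ ℤ}
    (hd : ∀ p, P p → d (a p) = 1) {b : σ →₀ ℕ} (hb : ∀ p, b p ≠ 0 → P p) :
    (b.degree : ℤ) = d (Finsupp.linearCombination ℕ a b) := by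
  rw [Finsupp.degree_eq_sum, Finsupp.linearCombination_apply, Finsupp.sum_fintype _ _ (by simp),
    map_sum]
  push_cast
  refine Finset.sum_congr rfl fun p _ => ?_
  rw [map_nsmul, nsmul_eq_mul]
  by_cases h : b p = 0
  · simp [h]
  · simp [hd p (hb p h)]

/-- For a nearly compressed configuration, a nonstandard monomial for a suitable reverse
lexicographic order is divisible by a squarefree nonstandard monomial. -/
theorem IsNearlyCompressed.exists_squarefree [Fintype σ] {a : σ → κ → ℤ} {d : (κ → ℤ) →+ ℤ}
    {g : γ → (κ → ℤ) →+ ℤ} {D : Set {p // P p}}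
    (ha : IsNearlyCompressed (fun p : {p // P p} => a p) d g D)
    {m : MonomialOrder σ} (hm : IsRevLex m)
    (hD : ∀ p ∉ D, ∀ q ∈ D, Finsupp.single p.1 1 ≺[m] Finsupp.single q.1 1)
    {u w : σ →₀ ℕ} (hu : ∀ p, u p ≠ 0 → P p) (hw : ∀ p, w p ≠ 0 → P p)
    (huw : Finsupp.linearCombination ℕ a u = Finsupp.linearCombination ℕ a w)
    (hlt : w ≺[m] u) :
    ∃ s t : σ →₀ ℕ, (∀ p, s p ≤ 1) ∧ s ≤ u ∧ (∀ p, t p ≠ 0 → P p) ∧ t ≺[m] s ∧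
      Finsupp.linearCombination ℕ a s = Finsupp.linearCombination ℕ a t := by
  classical
  have hd : ∀ p, P p → d (a p) = 1 := fun p hp => ha.degree ⟨p, hp⟩
  have hsum : ∀ (c : γ) (b : σ →₀ ℕ),
      g c (Finsupp.linearCombination ℕ a b) = ∑ p, (b p : ℤ) * g c (a p) := fun c b => by
    rw [Finsupp.linearCombination_apply, Finsupp.sum_fintype _ _ (by simp), map_sum]
    exact Finset.sum_congr rfl fun p _ => by rw [map_nsmul, nsmul_eq_mul]
  have hdiff : ∀ c, ∑ p, ((u p : ℤ) - w p) * g c (a p) = 0 := fun c => by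
    have h1 := congrArg (g c) huw
    rw [hsum, hsum] at h1
    simp only [sub_mul, Finset.sum_sub_distrib, h1, sub_self]
  have hnP : ∀ p, ¬ P p → (u p : ℤ) - w p = 0 := fun p hp => by
    rw [not_not.1 (mt (hu p) hp), not_not.1 (mt (hw p) hp), sub_self]
  -- `i` is the smallest variable in which `u` and `w` differ; equal images force equal degrees,
  -- which excludes the other case of the order.
  obtain ⟨i, hi, hbelow⟩ : ∃ i, u i < w i ∧
      ∀ j, Finsupp.single j 1 ≺[m] Finsupp.single i 1 → w j = u j := by
    rcases (hm w u).1 hlt with h | h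
    · have h1 := degree_eq_of_support hd hu
      have h2 := degree_eq_of_support hd hw
      rw [huw] at h1
      omega
    · exact h.2
  have hiP : P i := hw i (by omega)
  -- Otherwise everything outside `D` lies below `i` and cancels, and the dual functional of `i`
  -- yields `u i = w i`.
  have hiD : ⟨i, hiP⟩ ∉ D := fun hiD => by
    obtain ⟨c, hc, hc'⟩ := ha.dual _ hiD
    have h1 := hdiff c
    rw [Finset.sum_eq_single i] at h1
    · simp only [hc] at h1
      omega
    · intro p _ hpi
      by_cases hp : P p
      · by_cases hpD : ⟨p, hp⟩ ∈ D
        · rw [hc' _ hpD (by simpa using hpi), mul_zero]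
        · rw [hbelow p (hD _ hpD _ hiD), sub_self, zero_mul]
      · rw [hnP p hp, zero_mul]
    · simp
  -- The squarefree divisor: the variables whose exponent in `u` exceeds that in `w`.
  let s : σ →₀ ℕ := Finsupp.equivFunOnFinite.symm fun p => if w p < u p then 1 else 0
  have hs : ∀ p, s p = if w p < u p then 1 else 0 := fun p => rfl
  have hsP : ∀ p, s p ≠ 0 → P p := fun p hp => by
    refine hu p fun h => hp ?_
    rw [hs, if_neg (by omega)]
  have hnn : ∀ p c, P p → 0 ≤ g c (a p) := fun p c hp => ha.nonneg c ⟨p, hp⟩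
  obtain ⟨M, hM⟩ := ha.generate (Finsupp.linearCombination ℕ a s - a i) fun c => by
    have hle := ha.height_le _ hiD c
    simp only at hle
    rw [map_sub, hsum]
    have hterm : ∀ p ∈ Finset.univ, 0 ≤ (s p : ℤ) * g c (a p) := fun p _ => by
      by_cases h : s p = 0
      · simp [h]
      · exact mul_nonneg (by positivity) (hnn p c (hsP p h))
    rcases (hnn i c hiP).eq_or_lt with h0 | h0
    · rw [← h0, sub_zero]
      exact Finset.sum_nonneg hterm
    -- `u - w` has total height 0 under `g c` and a negative term at `i`, so some term is positive.
    -- Its variable occurs in `s`.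
    · obtain ⟨j, hj⟩ : ∃ j, 0 < ((u j : ℤ) - w j) * g c (a j) := by
        by_contra! hcon
        have h1 := (Finset.sum_eq_zero_iff_of_nonpos fun j _ => hcon j).1 (hdiff c) i
          (Finset.mem_univ i)
        rcases mul_eq_zero.1 h1 with h | h <;> omega
      have hjP : P j := by
        by_contra h
        rw [hnP j h, zero_mul] at hj
        exact lt_irrefl _ hj
      have hgj : 0 < g c (a j) := (hnn j c hjP).lt_of_ne fun h => by simp [← h] at hj
      have hwu : w j < u j := by
        have := pos_of_mul_pos_left hj hgj.le
        omega
      have h1 := Finset.single_le_sum hterm (Finset.mem_univ j)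
      rw [hs, if_pos hwu] at h1
      push_cast at h1
      omega
  let t : σ →₀ ℕ := Finsupp.single i 1 + (M.map fun j => Finsupp.single j.1 1).sum
  have ht : Finsupp.linearCombination ℕ a t = Finsupp.linearCombination ℕ a s := by
    rw [map_add, Finsupp.linearCombination_single, one_smul, map_multiset_sum, Multiset.map_map,
      ← eq_sub_iff_add_eq', hM]
    congr 1
    exact Multiset.map_congr rfl fun j _ => by simp
  have htP : ∀ p, t p ≠ 0 → P p := fun p hp => by
    by_contra hnot
    refine hp ?_
    have hne : p ≠ i := fun h => hnot (h ▸ hiP)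
    rw [Finsupp.add_apply, Finsupp.single_eq_of_ne hne, zero_add,
      ← Finsupp.applyAddHom_apply, map_multiset_sum, Multiset.map_map]
    refine Multiset.sum_eq_zero fun x hx => ?_
    obtain ⟨j, -, rfl⟩ := Multiset.mem_map.1 hx
    simp only [Function.comp_apply, Finsupp.applyAddHom_apply]
    have hne' : p ≠ j := fun h => hnot (h ▸ j.2)
    exact Finsupp.single_eq_of_ne hne'
  have hti : 0 < t i := by
    simp [t]
  have hsi : s i = 0 := by rw [hs, if_neg (by omega)]
  refine ⟨s, t, fun p => ?_, fun p => ?_, htP, ?_, ht.symm⟩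
  · rw [hs]; split_ifs <;> simp
  · rw [hs]; split_ifs <;> omega
  · refine (hm t s).2 (Or.inr ⟨?_, ?_⟩)
    · have h1 := degree_eq_of_support hd hsP
      have h2 := degree_eq_of_support hd htP
      rw [ht] at h2
      omega
    -- The smallest variable `k` where `t` and `s` differ is at most `i`. Up to `i` the exponents of
    -- `s` vanish, so `t k > s k`.
    · obtain ⟨k, hk, hmin⟩ := (Finset.univ.filter fun p => t p ≠ s p).exists_min_image
        (fun p => m.toSyn (Finsupp.single p 1)) ⟨i, by simp; omega⟩
      have hmin' : ∀ j, Finsupp.single j 1 ≺[m] Finsupp.single k 1 → t j = s j := fun j hj => by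
        by_contra hne
        exact absurd (hmin j (by simpa using hne)) (not_le.2 hj)
      refine ⟨k, ?_, hmin'⟩
      have hki : s k = 0 := by
        rcases (hmin i (by simp; omega)).lt_or_eq with h | h
        · rw [hs, if_neg (by rw [hbelow k h]; exact lt_irrefl _)]
        · rw [single_injective_toSyn m h, hsi]
      have := (Finset.mem_filter.1 hk).2
      omega

variable {e : σ → κ →₀ ℕ} {φ : MvPolynomial σ ℂ →ₐ[ℂ] MvPolynomial κ ℂ}

theorem map_monomial_of_support [Fintype σ] (hφ : ∀ p, P p → φ (X p) = monomial (e p) 1)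
    {b : σ →₀ ℕ} (hb : ∀ p, b p ≠ 0 → P p) (c : ℂ) :
    φ (monomial b c) = monomial (Finsupp.linearCombination ℕ e b) c := by
  rw [monomial_eq, map_mul, algHom_C, Finsupp.prod_fintype _ _ (by simp), map_prod,
    Finsupp.linearCombination_apply, Finsupp.sum_fintype _ _ (by simp),
    ← mul_one c, ← C_mul_monomial, monomial_sum_one, mul_one, algebraMap_eq]
  congr 1
  refine Finset.prod_congr rfl fun p _ => ?_
  by_cases h : b p = 0
  · simp [h]
  · rw [map_pow, hφ p (hb p h), monomial_pow, one_pow]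

theorem map_monomial_eq_zero [Fintype σ] (hφ : ∀ p, ¬ P p → φ (X p) = 0)
    {b : σ →₀ ℕ} {p : σ} (hp : ¬ P p) (hb : b p ≠ 0) (c : ℂ) : φ (monomial b c) = 0 := by
  rw [monomial_eq, map_mul, Finsupp.prod_fintype _ _ (by simp), map_prod,
    Finset.prod_eq_zero (Finset.mem_univ p) (by rw [map_pow, hφ p hp, zero_pow hb]), mul_zero]

/-- A leading monomial of the kernel of a monomial map has the same image as a smaller
monomial. -/
theorem exists_lt_of_mem_ker [Fintype σ] (hφ : ∀ p, P p → φ (X p) = monomial (e p) 1)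
    (hφ' : ∀ p, ¬ P p → φ (X p) = 0) (m : MonomialOrder σ) {f : MvPolynomial σ ℂ}
    (hf : φ f = 0) (hf0 : f ≠ 0) (hP : ∀ p, m.degree f p ≠ 0 → P p) :
    ∃ w : σ →₀ ℕ, (∀ p, w p ≠ 0 → P p) ∧ w ≺[m] m.degree f ∧
      Finsupp.linearCombination ℕ e w = Finsupp.linearCombination ℕ e (m.degree f) := by
  classical
  by_contra! hcon
  have h1 : φ f = ∑ b ∈ f.support, φ (monomial b (f.coeff b)) := by
    conv_lhs => rw [f.as_sum, map_sum]
  rw [hf] at h1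
  -- If no smaller monomial shares the image of the leading one, nothing cancels the leading
  -- coefficient in `φ f`.
  have h2 := congrArg (coeff (Finsupp.linearCombination ℕ e (m.degree f))) h1
  rw [coeff_zero, coeff_sum, Finset.sum_eq_single (m.degree f),
    map_monomial_of_support hφ hP, coeff_monomial, if_pos rfl] at h2
  · exact hf0 ((m.coeff_degree_eq_zero_iff).1 h2.symm)
  · intro b hb hne
    by_cases hbP : ∀ p, b p ≠ 0 → P p
    · rw [map_monomial_of_support hφ hbP, coeff_monomial, if_neg]
      refine hcon b hbP (lt_of_le_of_ne (m.le_degree hb) fun h => hne (m.toSyn.injective h))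
    · push Not at hbP
      obtain ⟨p, hp, hp'⟩ := hbP
      rw [map_monomial_eq_zero hφ' hp' hp, coeff_zero]
  · intro h
    exact absurd (m.degree_mem_support hf0) h

theorem monomial_mem_initialIdeal {m : MonomialOrder σ} {I : Ideal (MvPolynomial σ ℂ)}
    {f : MvPolynomial σ ℂ} (hf : f ∈ I) {s : σ →₀ ℕ} (hs : m.leadingTerm f = monomial s 1) :
    monomial s (1 : ℂ) ∈ initialIdeal m I :=
  Ideal.subset_span ⟨f, hf, hs⟩

/-- A leading monomial that involves a variable outside `P` is divisible by that variable, which is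
itself in the kernel; any other is handled by `exists_squarefree`. -/
theorem IsNearlyCompressed.isSquarefreeMonomialIdeal [Fintype σ]
    (hφ : ∀ p, P p → φ (X p) = monomial (e p) 1) (hφ' : ∀ p, ¬ P p → φ (X p) = 0)
    {d : (κ → ℤ) →+ ℤ} {g : γ → (κ → ℤ) →+ ℤ} {D : Set {p // P p}}
    (ha : IsNearlyCompressed (fun (p : {p // P p}) x => (e p x : ℤ)) d g D)
    {m : MonomialOrder σ} (hm : IsRevLex m)
    (hD : ∀ p ∉ D, ∀ q ∈ D, Finsupp.single p.1 1 ≺[m] Finsupp.single q.1 1) :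
    IsSquarefreeMonomialIdeal (initialIdeal m (RingHom.ker φ)) := by
  classical
  have hcast : ∀ b : σ →₀ ℕ, Finsupp.linearCombination ℕ (fun p x => (e p x : ℤ)) b =
      fun x => (Finsupp.linearCombination ℕ e b x : ℤ) := fun b => by
    ext x
    rw [Finsupp.linearCombination_apply, Finsupp.linearCombination_apply,
      Finsupp.sum_fintype _ _ (by simp), Finsupp.sum_fintype _ _ (by simp)]
    simp [Finset.sum_apply, Finsupp.finsetSum_apply]
  refine ⟨{s | (∀ i, s i ≤ 1) ∧ monomial s (1 : ℂ) ∈ initialIdeal m (RingHom.ker φ)},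
    fun s hs => hs.1, le_antisymm ?_ ?_⟩
  · refine Ideal.span_le.2 ?_
    rintro _ ⟨f, hf, rfl⟩
    rcases eq_or_ne f 0 with rfl | hf0
    · simp
    suffices h : ∃ s : σ →₀ ℕ, s ≤ m.degree f ∧ (∀ i, s i ≤ 1) ∧
        monomial s (1 : ℂ) ∈ initialIdeal m (RingHom.ker φ) by
      obtain ⟨s, hle, hs⟩ := h
      have hmul : m.leadingTerm f =
          monomial (m.degree f - s) (m.leadingCoeff f) * monomial s 1 := by
        rw [monomial_mul, mul_one, tsub_add_cancel_of_le hle]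
        rfl
      rw [hmul]
      exact Ideal.mul_mem_left _ _ (Ideal.subset_span ⟨s, hs, rfl⟩)
    by_cases hP : ∀ p, m.degree f p ≠ 0 → P p
    · obtain ⟨w, hw, hlt, hwe⟩ := exists_lt_of_mem_ker hφ hφ' m hf hf0 hP
      obtain ⟨s, t, hs1, hsle, htP, hts, hst⟩ :=
        ha.exists_squarefree (a := fun p x => (e p x : ℤ)) hm hD hP hw
          (by rw [hcast, hcast, hwe]) hlt
      have hsP : ∀ p, s p ≠ 0 → P p := fun p hp => hP p fun h => hp (by
        have := hsle p
        omega)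
      have hst' : Finsupp.linearCombination ℕ e s = Finsupp.linearCombination ℕ e t := by
        ext x
        have := congrFun hst x
        simp only [hcast] at this
        exact_mod_cast this
      refine ⟨s, hsle, hs1, monomial_mem_initialIdeal (f := monomial s 1 - monomial t 1) ?_ ?_⟩
      · rw [RingHom.mem_ker, map_sub, map_monomial_of_support hφ hsP,
          map_monomial_of_support hφ htP, hst', sub_self]
      · have hlt' : m.degree (monomial t (1 : ℂ)) ≺[m] m.degree (monomial s (1 : ℂ)) := by
          simpa [m.degree_monomial] using hts
        rw [MonomialOrder.leadingTerm, m.leadingCoeff_sub_of_lt hlt', m.degree_sub_of_lt hlt']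
        simp [m.degree_monomial]
    · push Not at hP
      obtain ⟨p, hp, hp'⟩ := hP
      refine ⟨Finsupp.single p 1, ?_, fun i => ?_, monomial_mem_initialIdeal (f := X p) ?_ ?_⟩
      · rw [Finsupp.single_le_iff]
        omega
      · rw [Finsupp.single_apply]
        split_ifs <;> simp
      · rw [RingHom.mem_ker, hφ' p hp']
      · exact m.leadingTerm_monomial _ _
  · refine Ideal.span_le.2 ?_
    rintro _ ⟨s, hs, rfl⟩
    exact hs.2

end InitialIdeal

/-! ### Inequalities, walk vectors, and operations on treks. -/

section TrekVectors

open scoped Classical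

variable {n : ℕ} {G : DAG n} {i j k v : Fin n}

theorem DAG.skeleton_adj_of_adj (h : G.Adj i j) : G.skeleton.Adj i j :=
  ⟨(G.lt_of_adj _ _ h).ne, Or.inl h⟩

theorem DAG.Edge.mk_eq_mk_iff {e f : G.Edge} : s(e.1.1, e.1.2) = s(f.1.1, f.1.2) ↔ e = f := by
  constructor
  · intro h
    have he := G.lt_of_adj _ _ e.2
    have hf := G.lt_of_adj _ _ f.2
    rcases Sym2.eq_iff.1 h with ⟨h1, h2⟩ | ⟨h1, h2⟩
    · exact Subtype.ext (Prod.ext h1 h2)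
    · rw [h1, h2] at he
      exact absurd he hf.asymm
  · rintro rfl
    rfl

theorem DAG.exists_edge_of_skeleton_adj (h : G.skeleton.Adj i j) :
    ∃ e : G.Edge, s(e.1.1, e.1.2) = s(i, j) := by
  rcases h.2 with h | h
  · exact ⟨⟨(i, j), h⟩, rfl⟩
  · exact ⟨⟨(j, i), h⟩, Sym2.eq_swap⟩

theorem DAG.sum_edges (p : G.skeleton.Walk i j) (F : Sym2 (Fin n) → ℤ) :
    ∑ e : G.Edge, F s(e.1.1, e.1.2) * p.edges.count s(e.1.1, e.1.2) = (p.edges.map F).sum := by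
  induction p with
  | nil => simp
  | cons h p ih =>
    obtain ⟨e₀, he₀⟩ := G.exists_edge_of_skeleton_adj h
    simp only [SimpleGraph.Walk.edges_cons, List.map_cons, List.sum_cons, ← ih, List.count_cons,
      Nat.cast_add, mul_add, Finset.sum_add_distrib, ← he₀]
    rw [add_comm]
    congr 1
    rw [Finset.sum_eq_single e₀]
    · simp
    · intro e _ hne
      have : ¬ s(e₀.1.1, e₀.1.2) = s(e.1.1, e.1.2) := fun h =>
        hne (DAG.Edge.mk_eq_mk_iff.1 h).symm
      simp only [beq_iff_eq, if_neg this, Nat.cast_zero, mul_zero]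
    · simp

/-- Each visit of a walk to `w` uses two incident edges, except that each end of the walk accounts
for one fewer. -/
theorem sum_edges_incident {V : Type*} [DecidableEq V] {H : SimpleGraph V} {x y : V}
    (p : H.Walk x y) (w : V) :
    (p.edges.map fun e => if w ∈ e then (1 : ℤ) else 0).sum =
      2 * p.support.count w - (if w = x then 1 else 0) - (if w = y then 1 else 0) := by
  induction p with
  | nil =>
    simp only [SimpleGraph.Walk.edges_nil, List.map_nil, List.sum_nil,
      SimpleGraph.Walk.support_nil, List.count_singleton, beq_iff_eq]
    simp only [eq_comm (a := w)]
    split_ifs <;> simp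
  | @cons a b c h p ih =>
    rw [SimpleGraph.Walk.edges_cons, List.map_cons, List.sum_cons, ih,
      SimpleGraph.Walk.support_cons, List.count_cons]
    have hne := h.ne
    have : (if w ∈ s(a, b) then (1 : ℤ) else 0) =
        (if w = a then 1 else 0) + (if w = b then 1 else 0) := by
      simp only [Sym2.mem_iff]
      by_cases h1 : w = a
      · subst h1
        simp [hne]
      · simp [h1]
    rw [this]
    simp only [beq_iff_eq, eq_comm (a := a)]
    push_cast
    ring

/-- The flow of `z` into the vertex `v`. -/
noncomputable def DAG.inflow (G : DAG n) (v : Fin n) : (G.Param → ℤ) →+ ℤ :=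
  ∑ e : G.Edge with e.1.2 = v, Pi.evalAddMonoidHom (fun _ => ℤ) (Sum.inr e)

/-- The flow of `z` out of the vertex `v`. -/
noncomputable def DAG.outflow (G : DAG n) (v : Fin n) : (G.Param → ℤ) →+ ℤ :=
  ∑ e : G.Edge with e.1.1 = v, Pi.evalAddMonoidHom (fun _ => ℤ) (Sum.inr e)

/-- The functional that counts the treks through the vertex `v`. -/
noncomputable def DAG.visits (G : DAG n) (v : Fin n) : (G.Param → ℤ) →+ ℤ :=
  Pi.evalAddMonoidHom (fun _ => ℤ) (Sum.inl v) + G.inflow v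

theorem DAG.inflow_apply (v : Fin n) (z : G.Param → ℤ) :
    G.inflow v z = ∑ e : G.Edge, if e.1.2 = v then z (Sum.inr e) else 0 := by
  rw [DAG.inflow, AddMonoidHom.finsetSum_apply, Finset.sum_filter]
  rfl

theorem DAG.outflow_apply (v : Fin n) (z : G.Param → ℤ) :
    G.outflow v z = ∑ e : G.Edge, if e.1.1 = v then z (Sum.inr e) else 0 := by
  rw [DAG.outflow, AddMonoidHom.finsetSum_apply, Finset.sum_filter]
  rfl

theorem DAG.visits_apply (v : Fin n) (z : G.Param → ℤ) :
    G.visits v z = z (Sum.inl v) + G.inflow v z := rfl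

/-- The index set of the inequalities that describe the polytope of a tree. -/
inductive DAG.Ineq (G : DAG n) : Type
  | param (x : G.Param)
  | slack (v : Fin n)
  | branch (e : G.Edge)

/-- The functionals of the inequalities that describe the polytope of a tree: the parameters,
the numbers of ends of treks at a vertex, and the numbers of treks that visit a vertex without
leaving it along a given edge. -/
noncomputable def DAG.Ineq.functional : G.Ineq → (G.Param → ℤ) →+ ℤ
  | .param x => Pi.evalAddMonoidHom (fun _ => ℤ) x
  | .slack v => G.visits v + G.visits v - G.inflow v - G.outflow v
  | .branch e => G.visits e.1.1 - Pi.evalAddMonoidHom (fun _ => ℤ) (Sum.inr e)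

theorem DAG.Ineq.param_apply (x : G.Param) (z : G.Param → ℤ) :
    (DAG.Ineq.param x).functional z = z x := rfl

theorem DAG.Ineq.slack_apply (v : Fin n) (z : G.Param → ℤ) :
    (DAG.Ineq.slack v).functional z =
      G.visits v z + G.visits v z - G.inflow v z - G.outflow v z := rfl

theorem DAG.Ineq.branch_apply (e : G.Edge) (z : G.Param → ℤ) :
    (DAG.Ineq.branch e).functional z = G.visits e.1.1 z - z (Sum.inr e) := rfl

/-- Visits and edge weights are additive under walk operations and determine the vector; identities
between walk vectors are checked in these coordinates. -/
theorem DAG.ext_visits {z w : G.Param → ℤ} (h : ∀ v, G.visits v z = G.visits v w)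
    (h' : ∀ e, z (Sum.inr e) = w (Sum.inr e)) : z = w := by
  ext (v | e)
  · have h1 := h v
    have h2 : G.inflow v z = G.inflow v w := by simp only [DAG.inflow_apply, h']
    rw [DAG.visits_apply, DAG.visits_apply, h2] at h1
    exact add_right_cancel h1
  · exact h' e

/-- The vector with the numbers of visits of a walk at the vertices and edges as
coordinates, in terms of the parameters. -/
noncomputable def walkVector (p : G.skeleton.Walk i j) : G.Param → ℤ :=
  Sum.elim
    (fun v => p.support.count v -
      ∑ e : G.Edge, if e.1.2 = v then (p.edges.count s(e.1.1, e.1.2) : ℤ) else 0)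
    (fun e => p.edges.count s(e.1.1, e.1.2))

theorem walkVector_inr (p : G.skeleton.Walk i j) (e : G.Edge) :
    walkVector p (Sum.inr e) = p.edges.count s(e.1.1, e.1.2) := rfl

theorem visits_walkVector (p : G.skeleton.Walk i j) (v : Fin n) :
    G.visits v (walkVector p) = p.support.count v := by
  simp [DAG.visits_apply, DAG.inflow_apply, walkVector]

theorem slack_walkVector (p : G.skeleton.Walk i j) (v : Fin n) :
    (DAG.Ineq.slack v).functional (walkVector p) =
      (if v = i then 1 else 0) + (if v = j then 1 else 0) := by
  have h : G.inflow v (walkVector p) + G.outflow v (walkVector p) =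
      (p.edges.map fun e => if v ∈ e then (1 : ℤ) else 0).sum := by
    rw [← G.sum_edges, DAG.inflow_apply, DAG.outflow_apply, ← Finset.sum_add_distrib]
    refine Finset.sum_congr rfl fun e _ => ?_
    have hne := (G.lt_of_adj _ _ e.2).ne
    simp only [walkVector_inr, Sym2.mem_iff, eq_comm (b := v)]
    by_cases h1 : v = e.1.1
    · have h2 : v ≠ e.1.2 := h1 ▸ hne
      simp [h1, hne]
    · simp [h1]
  rw [sum_edges_incident] at h
  rw [DAG.Ineq.slack_apply, visits_walkVector]
  linarith

theorem walkVector_reverse (p : G.skeleton.Walk i j) : walkVector p.reverse = walkVector p := by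
  refine DAG.ext_visits (fun v => ?_) fun e => ?_
  · simp [visits_walkVector]
  · simp [walkVector_inr]

/-- A walk is a trek if it is a path without colliders. -/
def IsTrek (p : G.skeleton.Walk i j) : Prop :=
  p.IsPath ∧ ∀ u w k : Fin n, G.Uses p u k → G.Uses p w k → u = w

/-- A walk without repeated vertices and colliders as a trek. -/
def IsTrek.toTrek {p : G.skeleton.Walk i j} (hp : IsTrek p) : G.Trek i j := ⟨⟨p, hp.1⟩, hp.2⟩

theorem isTrek_nil : IsTrek (SimpleGraph.Walk.nil : G.skeleton.Walk i i) :=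
  ⟨SimpleGraph.Walk.IsPath.nil, fun u w k h => by simp [DAG.Uses] at h⟩

theorem IsTrek.reverse {p : G.skeleton.Walk i j} (hp : IsTrek p) : IsTrek p.reverse :=
  ⟨hp.1.reverse, fun u w k h h' => hp.2 u w k ⟨h.1, by simpa using h.2⟩ ⟨h'.1, by simpa using h'.2⟩⟩

/-- Without colliders, at most one edge of the trek points into `v`. -/
theorem inflow_walkVector_le {p : G.skeleton.Walk i j} (hp : IsTrek p) (v : Fin n) :
    G.inflow v (walkVector p) ≤ p.support.count v := by
  rw [DAG.inflow_apply]
  have hcount : ∀ e, p.edges.count e ≤ 1 := List.nodup_iff_count_le_one.1 hp.1.isTrail.edges_nodup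
  by_cases h : ∃ u, G.Uses p u v
  · obtain ⟨u, hu⟩ := h
    rw [Finset.sum_eq_single ⟨(u, v), hu.1⟩]
    · have h1 : 0 < p.support.count v :=
        List.count_pos_iff.2 (p.snd_mem_support_of_mem_edges hu.2)
      have h2 := hcount s(u, v)
      simp only [walkVector_inr, if_true]
      omega
    · intro e _ hne
      split_ifs with hev
      · rw [walkVector_inr, List.count_eq_zero_of_not_mem, Nat.cast_zero]
        intro hmem
        subst hev
        exact hne (Subtype.ext (Prod.ext (hp.2 _ _ _ ⟨e.2, hmem⟩ hu) rfl))
      · rfl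
    · simp
  · rw [Finset.sum_eq_zero]
    · positivity
    · intro e _
      split_ifs with hev
      · rw [walkVector_inr, List.count_eq_zero_of_not_mem, Nat.cast_zero]
        intro hmem
        subst hev
        exact h ⟨_, e.2, hmem⟩
      · rfl

/-- Each edge has one head, so the sum is the number of visited vertices minus the number of edges.
-/
theorem sum_inl_walkVector (p : G.skeleton.Walk i j) :
    ∑ v, walkVector p (Sum.inl v) = 1 := by
  simp only [walkVector, Sum.elim_inl, Finset.sum_sub_distrib]
  rw [Finset.sum_comm]
  simp only [Finset.sum_ite_eq, Finset.mem_univ, if_true]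
  have h := G.sum_edges p fun _ => 1
  simp only [one_mul, List.map_const', List.sum_replicate, SimpleGraph.Walk.length_edges] at h
  have h' : ∑ v, p.support.count v = p.support.length := by
    simpa using Multiset.sum_count_eq_card (s := Finset.univ) (m := (p.support : Multiset (Fin n)))
      (by simp)
  rw [h, ← Nat.cast_sum, h', SimpleGraph.Walk.length_support]
  simp

theorem IsTrek.walkVector_inl_nonneg {p : G.skeleton.Walk i j} (hp : IsTrek p) (v : Fin n) :
    0 ≤ walkVector p (Sum.inl v) := by
  have h1 := inflow_walkVector_le hp v
  have h2 := visits_walkVector p v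
  rw [DAG.visits_apply] at h2
  linarith

theorem IsTrek.count_support_le {p : G.skeleton.Walk i j} (hp : IsTrek p) (v : Fin n) :
    p.support.count v ≤ 1 :=
  List.nodup_iff_count_le_one.1 hp.1.support_nodup v

theorem IsTrek.count_edges_le {p : G.skeleton.Walk i j} (hp : IsTrek p) (e : Sym2 (Fin n)) :
    p.edges.count e ≤ 1 :=
  List.nodup_iff_count_le_one.1 hp.1.isTrail.edges_nodup e

theorem DAG.Trek.isTrek (P : G.Trek i j) : IsTrek P.walk := ⟨P.1.2, P.2⟩

/-- The exponent vector of a trek is its walk vector. -/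
theorem DAG.Trek.exponent_eq (P : G.Trek i j) (x : G.Param) :
    (P.exponent x : ℤ) = walkVector P.walk x := by
  have hT := P.isTrek
  rcases x with v | e
  · obtain ⟨htop, huse⟩ := P.exists_top.choose_spec
    change P.top ∈ P.walk.support at htop
    change ∀ k, ¬ G.Uses P.walk k P.top at huse
    have h1 : walkVector P.walk (Sum.inl P.top) = 1 := by
      have h2 := visits_walkVector P.walk P.top
      have h3 : G.inflow P.top (walkVector P.walk) = 0 := by
        rw [DAG.inflow_apply]
        refine Finset.sum_eq_zero fun e _ => ?_
        split_ifs with hev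
        · rw [walkVector_inr, List.count_eq_zero_of_not_mem, Nat.cast_zero]
          intro hmem
          exact huse e.1.1 ⟨hev ▸ e.2, hev ▸ hmem⟩
        · rfl
      rw [DAG.visits_apply, h3, List.count_eq_one_of_mem hT.1.support_nodup htop] at h2
      simpa using h2
    have hsum := sum_inl_walkVector P.walk
    rw [← Finset.add_sum_erase _ _ (Finset.mem_univ P.top), h1] at hsum
    -- The vertex coordinates are nonnegative with sum 1, and the top already accounts for 1.
    have hzero := (Finset.sum_eq_zero_iff_of_nonneg fun v _ =>
      hT.walkVector_inl_nonneg v).1 (by linarith : ∑ v ∈ Finset.univ.erase P.top,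
        walkVector P.walk (Sum.inl v) = 0)
    simp only [DAG.Trek.exponent, Sum.elim_inl]
    split_ifs with hv
    · rw [hv, h1]; rfl
    · rw [hzero v (by simp [hv])]; rfl
  · simp only [DAG.Trek.exponent, Sum.elim_inr, walkVector_inr]
    congr 1
    split_ifs with h
    · exact (List.count_eq_one_of_mem hT.1.isTrail.edges_nodup h.2).symm
    · exact (List.count_eq_zero_of_not_mem fun hmem => h ⟨e.2, hmem⟩).symm

/-- The new vertex `k` gains one visit and one unit of inflow, so no vertex coordinate changes. -/
theorem walkVector_cons_add (p : G.skeleton.Walk v j) (h : G.Adj v k) :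
    walkVector (SimpleGraph.Walk.cons (G.skeleton_adj_of_adj h).symm p) =
      walkVector p + Pi.single (Sum.inr ⟨(v, k), h⟩) 1 := by
  refine DAG.ext_visits (fun w => ?_) fun e => ?_
  · rw [map_add, visits_walkVector, visits_walkVector, SimpleGraph.Walk.support_cons,
      List.count_cons, DAG.visits_apply, DAG.inflow_apply, Finset.sum_eq_single ⟨(v, k), h⟩]
    · simp
    · intro e _ hne
      simp [hne]
    · simp
  · rw [Pi.add_apply, walkVector_inr, walkVector_inr, SimpleGraph.Walk.edges_cons, List.count_cons,
      Sym2.eq_swap (a := k)]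
    push_cast
    congr 1
    rw [Pi.single_apply]
    have := DAG.Edge.mk_eq_mk_iff (e := ⟨(v, k), h⟩) (f := e)
    simp only [beq_iff_eq, this, Sum.inr.injEq, eq_comm (b := e)]

/-- Exchanging tails at `v` preserves the total vector. -/
theorem walkVector_append_add (p q : Σ x, G.skeleton.Walk v x) (r : G.skeleton.Walk i v) :
    walkVector (r.append p.2) + walkVector q.2 = walkVector p.2 + walkVector (r.append q.2) := by
  refine DAG.ext_visits (fun w => ?_) fun e => ?_
  · rw [map_add, map_add]
    simp only [visits_walkVector, SimpleGraph.Walk.support_append, List.count_append]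
    rw [← p.2.cons_tail_support, ← q.2.cons_tail_support]
    simp only [List.tail_cons, List.count_cons]
    push_cast
    ring
  · simp only [Pi.add_apply, walkVector_inr, SimpleGraph.Walk.edges_append, List.count_append]
    push_cast
    ring

/-- A trek can be extended along an edge that points away from its end. -/
theorem IsTrek.cons (hG : G.skeleton.IsAcyclic) {p : G.skeleton.Walk v j} (hp : IsTrek p)
    (h : G.Adj v k) (hvk : s(v, k) ∉ p.edges) :
    IsTrek (SimpleGraph.Walk.cons (G.skeleton_adj_of_adj h).symm p) := by
  have hpath : (SimpleGraph.Walk.cons (G.skeleton_adj_of_adj h).symm p).IsPath := by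
    rw [hG.isPath_iff_isTrail, SimpleGraph.Walk.isTrail_cons]
    exact ⟨hp.1.isTrail, by rwa [Sym2.eq_swap]⟩
  have hk : k ∉ p.support := ((SimpleGraph.Walk.cons_isPath_iff _ _).1 hpath).2
  have key : ∀ u w, G.Uses (SimpleGraph.Walk.cons (G.skeleton_adj_of_adj h).symm p) u w →
      (u = v ∧ w = k) ∨ (G.Uses p u w ∧ w ≠ k) := by
    rintro u w ⟨hadj, hmem⟩
    rw [SimpleGraph.Walk.edges_cons, List.mem_cons] at hmem
    rcases hmem with hmem | hmem
    · rcases Sym2.eq_iff.1 hmem with ⟨rfl, rfl⟩ | h'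
      · exact absurd (G.lt_of_adj _ _ h) (G.lt_of_adj _ _ hadj).asymm
      · exact Or.inl h'
    · exact Or.inr ⟨⟨hadj, hmem⟩, fun hwk => hk (hwk ▸ p.snd_mem_support_of_mem_edges hmem)⟩
  refine ⟨hpath, fun u w c hu hw => ?_⟩
  rcases key _ _ hu with hu | hu <;> rcases key _ _ hw with hw | hw
  · rw [hu.1, hw.1]
  · exact absurd hu.2 hw.2
  · exact absurd hw.2 hu.2
  · exact hp.2 _ _ _ hu.1 hw.1

/-- Treks `r` and `p` can be joined at `v` if `p` leaves `v` along an edge `v → k` that `r`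
does not use. -/
theorem IsTrek.append (hG : G.skeleton.IsAcyclic) {r : G.skeleton.Walk i v}
    {p : G.skeleton.Walk v j} (hr : IsTrek r) (hp : IsTrek p) (h : G.Adj v k)
    (hvp : s(v, k) ∈ p.edges) (hvr : s(v, k) ∉ r.edges) : IsTrek (r.append p) := by
  cases p with
  | nil => simp at hvp
  | @cons _ w _ hadj p =>
    obtain ⟨hpp, hvs⟩ := (SimpleGraph.Walk.cons_isPath_iff _ _).1 hp.1
    have hvnot : ∀ u, s(v, u) ∉ p.edges := fun u hu => hvs (p.fst_mem_support_of_mem_edges hu)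
    have hwk : k = w := by
      rw [SimpleGraph.Walk.edges_cons, List.mem_cons] at hvp
      exact Sym2.congr_right.1 (hvp.resolve_right (hvnot k))
    subst hwk
    have hpath : (r.append (SimpleGraph.Walk.cons hadj p)).IsPath := by
      -- In a forest, a walk whose consecutive edges differ is a path, so only the junction at `v`
      -- needs checking.
      rw [hG.isPath_iff_isChain, SimpleGraph.Walk.edges_append, List.isChain_append]
      refine ⟨(hG.isPath_iff_isChain _).1 hr.1, (hG.isPath_iff_isChain _).1 hp.1, ?_⟩
      intro x hx y hy hxy
      simp only [SimpleGraph.Walk.edges_cons, List.head?_cons, Option.mem_some_iff] at hy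
      rw [← hy] at hxy
      exact hvr (hxy ▸ List.mem_of_getLast? hx)
    -- A common head would lie on both paths, hence be `v`; but the only edge of the second path at
    -- `v` points away from `v`.
    have hnot : ∀ u w c, G.Uses r u c → G.Uses (SimpleGraph.Walk.cons hadj p) w c → False := by
      rintro u w c ⟨-, hu⟩ ⟨hwc, hw⟩
      have hc1 : c ∈ r.support := r.snd_mem_support_of_mem_edges hu
      rw [SimpleGraph.Walk.edges_cons, List.mem_cons] at hw
      have hnodup := hpath.support_nodup
      rw [SimpleGraph.Walk.support_append, SimpleGraph.Walk.support_cons, List.tail_cons] at hnodup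
      have hdisj := List.disjoint_of_nodup_append hnodup
      rcases hw with hw | hw
      · rcases Sym2.eq_iff.1 hw with ⟨-, hck⟩ | ⟨hwk, hcv⟩
        · exact hdisj hc1 (hck ▸ p.start_mem_support)
        · subst hwk hcv
          exact (G.lt_of_adj _ _ h).asymm (G.lt_of_adj _ _ hwc)
      · exact hdisj hc1 (p.snd_mem_support_of_mem_edges hw)
    refine ⟨hpath, fun u w c hu hw => ?_⟩
    have hor : ∀ u c, G.Uses (r.append (SimpleGraph.Walk.cons hadj p)) u c →
        G.Uses r u c ∨ G.Uses (SimpleGraph.Walk.cons hadj p) u c := fun u c hu => by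
      have := hu.2
      rw [SimpleGraph.Walk.edges_append, List.mem_append] at this
      exact this.imp (fun h => ⟨hu.1, h⟩) fun h => ⟨hu.1, h⟩
    rcases hor _ _ hu with hu | hu <;> rcases hor _ _ hw with hw | hw
    · exact hr.2 _ _ _ hu hw
    · exact (hnot _ _ _ hu hw).elim
    · exact (hnot _ _ _ hw hu).elim
    · exact hp.2 _ _ _ hu hw

theorem IsTrek.of_subwalk {a b : Fin n} {q : G.skeleton.Walk a b} {p : G.skeleton.Walk i j}
    (hq : IsTrek q) (hp : p.IsPath) (h : p.edges ⊆ q.edges) : IsTrek p :=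
  ⟨hp, fun u w k hu hw => hq.2 u w k ⟨hu.1, h hu.2⟩ ⟨hw.1, h hw.2⟩⟩

end TrekVectors

/-! ### Decomposition of integral vectors into treks. -/

section Decomposition

open scoped Classical

variable {n : ℕ} {G : DAG n} {i j k v : Fin n}

/-- `z` is the vector of a trek. -/
def IsTrekVector (z : G.Param → ℤ) : Prop :=
  ∃ (i j : Fin n) (p : G.skeleton.Walk i j), IsTrek p ∧ z = walkVector p

theorem inflow_single (e : G.Edge) (v : Fin n) :
    G.inflow v (Pi.single (Sum.inr e) 1) = if e.1.2 = v then 1 else 0 := by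
  rw [DAG.inflow_apply, Finset.sum_eq_single e]
  · simp
  · intro f _ hne
    simp [hne]
  · simp

theorem outflow_single (e : G.Edge) (v : Fin n) :
    G.outflow v (Pi.single (Sum.inr e) 1) = if e.1.1 = v then 1 else 0 := by
  rw [DAG.outflow_apply, Finset.sum_eq_single e]
  · simp
  · intro f _ hne
    simp [hne]
  · simp

theorem visits_single (e : G.Edge) (v : Fin n) :
    G.visits v (Pi.single (Sum.inr e) 1) = if e.1.2 = v then 1 else 0 := by
  rw [DAG.visits_apply, inflow_single, Pi.single_eq_of_ne (by simp), zero_add]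

/-- A sum of trek vectors with a trek ending at `v` and enough treks through `v` that do not
use `v → k` remains a sum of trek vectors when the weight of `v → k` is raised by one. -/
theorem exists_extension (hG : G.skeleton.IsAcyclic) {M : Multiset (G.Param → ℤ)}
    (hM : ∀ z ∈ M, IsTrekVector z) (e : G.Edge)
    (hslack : 0 < (DAG.Ineq.slack e.1.1).functional M.sum)
    (hbranch : 0 < (DAG.Ineq.branch e).functional M.sum) :
    ∃ N : Multiset (G.Param → ℤ), (∀ z ∈ N, IsTrekVector z) ∧
      N.sum = M.sum + Pi.single (Sum.inr e) 1 := by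
  obtain ⟨⟨v, k⟩, hvk⟩ := e
  have hpos : ∀ f : (G.Param → ℤ) →+ ℤ, 0 < f M.sum → ∃ z ∈ M, 0 < f z := fun f hf => by
    by_contra! hcon
    rw [map_multiset_sum] at hf
    have h := Multiset.sum_le_card_nsmul (M.map f) 0 fun x hx => by
      obtain ⟨z, hz, rfl⟩ := Multiset.mem_map.1 hx
      exact hcon z hz
    rw [smul_zero] at h
    exact hf.not_ge h
  obtain ⟨z, hzM, hz⟩ := hpos _ hslack
  obtain ⟨b, p, hp, rfl⟩ : ∃ (b : Fin n) (p : G.skeleton.Walk v b), IsTrek p ∧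
      z = walkVector p := by
    obtain ⟨a, b, p, hp, rfl⟩ := hM z hzM
    rw [slack_walkVector] at hz
    by_cases ha : v = a
    · subst ha
      exact ⟨b, p, hp, rfl⟩
    · by_cases hb : v = b
      · subst hb
        exact ⟨a, p.reverse, hp.reverse, (walkVector_reverse p).symm⟩
      · simp [ha, hb] at hz
  -- If `p` already uses `v → k`, a second trek `q` through `v` avoiding this edge is cut at `v`:
  -- its first part continues along `p`, and its second part is extended by `v → k`.
  by_cases huse : s(v, k) ∈ p.edges
  · obtain ⟨y, hyM, hy⟩ := hpos _ hbranch
    obtain ⟨a, c, q, hq, rfl⟩ := hM y hyM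
    rw [DAG.Ineq.branch_apply, visits_walkVector, walkVector_inr] at hy
    have hvq : v ∈ q.support := List.count_pos_iff.1 (by simp only at hy; omega)
    have huq : s(v, k) ∉ q.edges := fun h => by
      have h1 := List.count_pos_iff.2 h
      have h2 := hq.count_support_le v
      simp only at hy
      omega
    have hne : walkVector q ≠ walkVector p := fun h => by
      have h1 := congrFun h (Sum.inr ⟨(v, k), hvk⟩)
      rw [walkVector_inr, walkVector_inr, List.count_eq_zero_of_not_mem huq] at h1
      have h2 := List.count_pos_iff.2 huse
      simp only at h1
      omega
    obtain ⟨M', rfl⟩ := Multiset.exists_cons_of_mem hzM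
    obtain ⟨M'', rfl⟩ := Multiset.exists_cons_of_mem
      ((Multiset.mem_cons.1 hyM).resolve_left hne)
    have hq1 : IsTrek (q.takeUntil v hvq) :=
      hq.of_subwalk (hq.1.takeUntil hvq) (q.edges_takeUntil_subset_edges hvq)
    have hq2 : IsTrek (q.dropUntil v hvq) :=
      hq.of_subwalk (hq.1.dropUntil hvq) (q.edges_dropUntil_subset_edges hvq)
    refine ⟨walkVector ((q.takeUntil v hvq).append p) ::ₘ
      walkVector (SimpleGraph.Walk.cons (G.skeleton_adj_of_adj hvk).symm (q.dropUntil v hvq)) ::ₘ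
        M'', ?_, ?_⟩
    · intro x hx
      rw [Multiset.mem_cons, Multiset.mem_cons] at hx
      rcases hx with rfl | rfl | hx
      · exact ⟨_, _, _, hq1.append hG hp hvk huse
          fun h => huq (q.edges_takeUntil_subset_edges hvq h), rfl⟩
      · exact ⟨_, _, _, hq2.cons hG hvk fun h => huq (q.edges_dropUntil_subset_edges hvq h), rfl⟩
      · exact hM x (by simp [hx])
    · have h := walkVector_append_add ⟨b, p⟩ ⟨c, q.dropUntil v hvq⟩ (q.takeUntil v hvq)
      simp only [SimpleGraph.Walk.take_spec] at h
      simp only [Multiset.sum_cons, walkVector_cons_add _ hvk]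
      rw [← add_assoc, ← add_assoc, h]
      abel
  · obtain ⟨M', rfl⟩ := Multiset.exists_cons_of_mem hzM
    refine ⟨walkVector (SimpleGraph.Walk.cons (G.skeleton_adj_of_adj hvk).symm p) ::ₘ M', ?_, ?_⟩
    · intro x hx
      rcases Multiset.mem_cons.1 hx with rfl | hx
      · exact ⟨_, _, _, hp.cons hG hvk huse, rfl⟩
      · exact hM x (Multiset.mem_cons_of_mem hx)
    · rw [Multiset.sum_cons, Multiset.sum_cons, walkVector_cons_add _ hvk]
      abel

theorem walkVector_nil (v : Fin n) :
    walkVector (SimpleGraph.Walk.nil : G.skeleton.Walk v v) = Pi.single (Sum.inl v) 1 := by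
  ext (w | e)
  · simp [walkVector, Pi.single_apply, List.count_singleton, eq_comm (a := w)]
  · simp [walkVector]

/-- An integral vector that satisfies all the inequalities is a sum of trek vectors. -/
theorem exists_sum_trekVectors (hG : G.skeleton.IsAcyclic) (N : ℕ) (z : G.Param → ℤ)
    (hz : ∀ c : G.Ineq, 0 ≤ c.functional z) (hN : ∑ e, z (Sum.inr e) = N) :
    ∃ M : Multiset (G.Param → ℤ), (∀ x ∈ M, IsTrekVector x) ∧ M.sum = z := by
  induction N generalizing z with
  | zero =>
    have hx : ∀ e, z (Sum.inr e) = 0 := fun e =>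
      (Finset.sum_eq_zero_iff_of_nonneg fun e _ => hz (.param (Sum.inr e))).1 hN e
        (Finset.mem_univ e)
    refine ⟨∑ v, Multiset.replicate (z (Sum.inl v)).toNat (Pi.single (Sum.inl v) 1), ?_, ?_⟩
    · intro x hx
      obtain ⟨v, -, hv⟩ := Multiset.mem_sum.1 hx
      rw [Multiset.eq_of_mem_replicate hv]
      exact ⟨v, v, .nil, isTrek_nil, (walkVector_nil v).symm⟩
    · rw [← Multiset.coe_sumAddMonoidHom, map_sum]
      simp only [Multiset.coe_sumAddMonoidHom, Multiset.sum_replicate]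
      ext (w | e)
      · have := hz (.param (Sum.inl w))
        rw [DAG.Ineq.param_apply] at this
        simp [Finset.sum_apply, Pi.single_apply, this]
      · simp [Finset.sum_apply, hx]
  | succ N ih =>
    have hxnn : ∀ e, 0 ≤ z (Sum.inr e) := fun e => hz (.param (Sum.inr e))
    -- Maximality of the head makes it a sink of the support of `z`, so lowering the weight of `e`
    -- keeps the inequalities at the head valid.
    obtain ⟨e, he, hmax⟩ := (Finset.univ.filter fun e : G.Edge => 0 < z (Sum.inr e)).exists_max_image
      (fun e => e.1.2) (by
        by_contra hcon
        rw [Finset.not_nonempty_iff_eq_empty, Finset.filter_eq_empty_iff] at hcon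
        have := Finset.sum_nonpos fun e he => not_lt.1 (hcon he)
        rw [hN] at this
        push_cast at this
        omega)
    have hepos : 0 < z (Sum.inr e) := (Finset.mem_filter.1 he).2
    have hout : ∀ f : G.Edge, f.1.1 = e.1.2 → z (Sum.inr f) = 0 := fun f hf => by
      by_contra hne
      have h1 := hmax f (by simpa using (hxnn f).lt_of_ne' hne)
      have h2 := G.lt_of_adj _ _ f.2
      rw [hf] at h2
      exact absurd h1 (not_le.2 h2)
    have hne : e.1.1 ≠ e.1.2 := (G.lt_of_adj _ _ e.2).ne
    have hinflow : 1 ≤ G.inflow e.1.2 z := by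
      rw [DAG.inflow_apply]
      have h1 := Finset.single_le_sum (f := fun f : G.Edge => if f.1.2 = e.1.2 then z (Sum.inr f) else 0)
        (fun f _ => by split_ifs <;> simp [hxnn]) (Finset.mem_univ e)
      simp only [if_true] at h1
      omega
    have houtflow : G.outflow e.1.2 z = 0 := by
      rw [DAG.outflow_apply]
      refine Finset.sum_eq_zero fun f _ => ?_
      split_ifs with h
      · exact hout f h
      · rfl
    have hvisits : G.inflow e.1.2 z ≤ G.visits e.1.2 z := by
      have := hz (.param (Sum.inl e.1.2))
      rw [DAG.Ineq.param_apply] at this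
      rw [DAG.visits_apply]
      omega
    let z' := z - Pi.single (Sum.inr e) 1
    have hslack : ∀ w, (DAG.Ineq.slack w).functional z' = (DAG.Ineq.slack w).functional z -
        (if e.1.2 = w then 1 else 0) + (if e.1.1 = w then 1 else 0) := fun w => by
      rw [DAG.Ineq.slack_apply, DAG.Ineq.slack_apply]
      simp only [z', map_sub, visits_single, inflow_single, outflow_single]
      ring
    have hbranch : ∀ f, (DAG.Ineq.branch f).functional z' = (DAG.Ineq.branch f).functional z -
        (if e.1.2 = f.1.1 then 1 else 0) + (if f = e then 1 else 0) := fun f => by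
      rw [DAG.Ineq.branch_apply, DAG.Ineq.branch_apply]
      simp only [z', map_sub, visits_single, Pi.sub_apply, Pi.single_apply, Sum.inr.injEq]
      ring
    have hz' : ∀ c : G.Ineq, 0 ≤ c.functional z' := by
      rintro ((w | f) | w | f)
      · have := hz (.param (Sum.inl w))
        rw [DAG.Ineq.param_apply] at this ⊢
        simpa [z'] using this
      · rw [DAG.Ineq.param_apply]
        simp only [z', Pi.sub_apply, Pi.single_apply, Sum.inr.injEq]
        have := hxnn f
        split_ifs with h
        · subst h; omega
        · omega
      · rw [hslack]
        have h1 := hz (.slack w)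
        by_cases hw : e.1.2 = w
        · subst hw
          rw [DAG.Ineq.slack_apply, houtflow, if_pos rfl, if_neg hne]
          omega
        · rw [if_neg hw]
          split_ifs <;> omega
      · rw [hbranch]
        have h1 := hz (.branch f)
        by_cases hw : e.1.2 = f.1.1
        · rw [DAG.Ineq.branch_apply, hout f hw.symm, ← hw, if_pos rfl]
          split_ifs <;> omega
        · rw [if_neg hw]
          split_ifs <;> omega
    obtain ⟨M, hM, hMz⟩ := ih z' hz' (by
      simp only [z', Pi.sub_apply, Finset.sum_sub_distrib, hN, Pi.single_apply, Sum.inr.injEq]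
      simp)
    -- Lowering the weight of `e` raised the slack at its tail and the branch functional of `e` by
    -- one, so both are positive at `z'`.
    obtain ⟨M', hM', hsum⟩ := exists_extension hG hM e
      (by
        rw [hMz, hslack, if_neg hne.symm, if_pos rfl]
        have := hz (.slack e.1.1)
        omega)
      (by
        rw [hMz, hbranch, if_neg hne.symm, if_pos rfl]
        have := hz (.branch e)
        omega)
    exact ⟨M', hM', by rw [hsum, hMz]; simp [z']⟩

/-! ### The configuration of a tree and its parametrization. -/

theorem DAG.IsTree.subsingleton_trek (hG : G.IsTree) (i j : Fin n) : Subsingleton (G.Trek i j) :=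
  ⟨fun P Q => Subtype.ext ((hG.isAcyclic.subsingleton_path i j).elim P.1 Q.1)⟩

theorem DAG.config_apply (p : G.TrekPair) :
    G.config p = walkVector (Classical.choice p.2).walk :=
  funext fun x => (Classical.choice p.2).exponent_eq x

theorem DAG.IsTree.config_eq (hG : G.IsTree) (p : G.TrekPair) (P : G.Trek p.1.1.1 p.1.1.2) :
    G.config p = walkVector P.walk := by
  rw [DAG.config_apply, (hG.subsingleton_trek _ _).elim (Classical.choice p.2) P]

theorem DAG.IsTree.exists_config_eq (hG : G.IsTree) {z : G.Param → ℤ} (hz : IsTrekVector z) :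
    ∃ p : G.TrekPair, G.config p = z := by
  obtain ⟨i, j, p, hp, rfl⟩ := hz
  rcases le_total i j with h | h
  · refine ⟨⟨⟨(i, j), h⟩, ⟨hp.toTrek⟩⟩, ?_⟩
    have := hG.config_eq ⟨⟨(i, j), h⟩, ⟨hp.toTrek⟩⟩ hp.toTrek
    exact this
  · refine ⟨⟨⟨(j, i), h⟩, ⟨hp.reverse.toTrek⟩⟩, ?_⟩
    have := hG.config_eq ⟨⟨(j, i), h⟩, ⟨hp.reverse.toTrek⟩⟩ hp.reverse.toTrek
    exact this.trans (walkVector_reverse p)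

/-- The configuration of a tree is nearly compressed, with the diagonal as exceptional set. -/
theorem DAG.IsTree.isNearlyCompressed (hG : G.IsTree) :
    IsNearlyCompressed G.config (∑ v, Pi.evalAddMonoidHom (fun _ => ℤ) (Sum.inl v))
      (DAG.Ineq.functional (G := G)) {p | p.1.1.1 = p.1.1.2} where
  degree p := by
    rw [DAG.config_apply, AddMonoidHom.finsetSum_apply]
    exact sum_inl_walkVector _
  nonneg c p := by
    rw [DAG.config_apply]
    have hP := (Classical.choice p.2).isTrek
    rcases c with (v | e) | v | e
    · exact hP.walkVector_inl_nonneg v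
    · rw [DAG.Ineq.param_apply, walkVector_inr]
      positivity
    · rw [slack_walkVector]
      positivity
    · rw [DAG.Ineq.branch_apply, visits_walkVector, walkVector_inr]
      have h1 := hP.count_edges_le s(e.1.1, e.1.2)
      by_cases h : s(e.1.1, e.1.2) ∈ (Classical.choice p.2).walk.edges
      · have := List.count_pos_iff.2 (SimpleGraph.Walk.fst_mem_support_of_mem_edges _ h)
        omega
      · rw [List.count_eq_zero_of_not_mem h]
        omega
  generate z hz := by
    have hnn : 0 ≤ ∑ e, z (Sum.inr e) := Finset.sum_nonneg fun e _ => hz (.param (Sum.inr e))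
    obtain ⟨M, hM, rfl⟩ := exists_sum_trekVectors hG.isAcyclic (∑ e, z (Sum.inr e)).toNat z hz
      (by rw [Int.toNat_of_nonneg hnn])
    have : CanLift (G.Param → ℤ) G.TrekPair G.config IsTrekVector :=
      ⟨fun z hz => hG.exists_config_eq hz⟩
    lift M to Multiset G.TrekPair using hM
    exact ⟨M, rfl⟩
  height_le p hpD c := by
    rw [DAG.config_apply]
    have hP := (Classical.choice p.2).isTrek
    rcases c with (v | e) | v | e
    · rw [DAG.Ineq.param_apply]
      have h1 := Finset.single_le_sum (fun v _ => hP.walkVector_inl_nonneg v) (Finset.mem_univ v)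
      rwa [sum_inl_walkVector] at h1
    · rw [DAG.Ineq.param_apply, walkVector_inr]
      exact_mod_cast hP.count_edges_le _
    · rw [slack_walkVector]
      have : ¬ p.1.1.1 = p.1.1.2 := hpD
      split_ifs with h1 h2
      -- Both ends of a trek coincide only on the diagonal, the one place where a slack equals 2.
      · exact absurd (h1.symm.trans h2) this
      all_goals simp
    · rw [DAG.Ineq.branch_apply, visits_walkVector, walkVector_inr]
      have := hP.count_support_le e.1.1
      omega
  dual := by
    have key : ∀ p : G.TrekPair, p.1.1.1 = p.1.1.2 →
        G.config p = Pi.single (Sum.inl p.1.1.1) 1 := by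
      rintro ⟨⟨⟨i, j⟩, hij⟩, hp⟩ (rfl : i = j)
      rw [hG.config_eq _ isTrek_nil.toTrek]
      exact walkVector_nil i
    intro p hp
    refine ⟨.param (Sum.inl p.1.1.1), ?_, fun q hq hqp => ?_⟩
    · rw [DAG.Ineq.param_apply, key p hp, Pi.single_eq_same]
    · rw [DAG.Ineq.param_apply, key q hq, Pi.single_eq_of_ne]
      intro h
      refine hqp (Subtype.ext (Subtype.ext (Prod.ext (Sum.inl_injective h).symm ?_)))
      rw [← hq, ← hp]
      exact (Sum.inl_injective h).symm

theorem DAG.IsTree.phi_X (hG : G.IsTree) (p : G.TrekPair) :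
    G.phi (MvPolynomial.X p.1) =
      MvPolynomial.monomial (Finsupp.equivFunOnFinite.symm (Classical.choice p.2).exponent) 1 := by
  have := hG.subsingleton_trek p.1.1.1 p.1.1.2
  rw [DAG.phi, MvPolynomial.aeval_X, Fintype.sum_subsingleton _ (Classical.choice p.2),
    DAG.Trek.monomial_eq, MvPolynomial.monomial_eq, Finsupp.prod_fintype _ _ (by simp)]
  simp

theorem DAG.phi_X_eq_zero {p : SigmaVar n} (hp : ¬ Nonempty (G.Trek p.1.1 p.1.2)) :
    G.phi (MvPolynomial.X p) = 0 := by
  rw [not_nonempty_iff] at hp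
  rw [DAG.phi, MvPolynomial.aeval_X, Fintype.sum_empty]

end Decomposition

end GaussianDAG

/-! ### The theorem for trees. -/

open scoped Classical in
theorem mainTheorem9 {n : ℕ} (T : GaussianDAG.DAG n) (hT : T.IsTree)
    (m : MonomialOrder (GaussianDAG.SigmaVar n)) (hm : GaussianDAG.IsRevLex m)
    (hdiag : ∀ p q : GaussianDAG.SigmaVar n, p.1.1 = p.1.2 → q.1.1 ≠ q.1.2 →
      Finsupp.single q 1 ≺[m] Finsupp.single p 1) :
    GaussianDAG.IsSquarefreeMonomialIdeal (GaussianDAG.initialIdeal m T.ideal) ∧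
      GaussianDAG.PullingUnimodular T.config
        (fun p q => Finsupp.single p.1 1 ≺[m] Finsupp.single q.1 1) := by
  have hc := hT.isNearlyCompressed
  constructor
  · let e : GaussianDAG.SigmaVar n → T.Param →₀ ℕ := fun p =>
      if h : Nonempty (T.Trek p.1.1 p.1.2) then
        Finsupp.equivFunOnFinite.symm (Classical.choice h).exponent else 0
    have he : ∀ p : T.TrekPair,
        e p.1 = Finsupp.equivFunOnFinite.symm (Classical.choice p.2).exponent :=
      fun p => dif_pos p.2
    have hconf : T.config = fun (p : T.TrekPair) x => (e p.1 x : ℤ) := by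
      funext p x
      rw [he]
      rfl
    rw [hconf] at hc
    exact hc.isSquarefreeMonomialIdeal (φ := T.phi)
      (fun p hp => by rw [he ⟨p, hp⟩]; exact hT.phi_X ⟨p, hp⟩)
      (fun p hp => T.phi_X_eq_zero hp) hm fun p hp q hq => hdiag q.1 p.1 hq hp
  · exact hc.pullingUnimodular (fun p q h => h.asymm) fun p hp q hq => hdiag q.1 p.1 hq hp
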